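/- Let $\mathbb{H}=\{z\in\mathbb{C}:\operatorname{Re} z>0\}$ and $t^+=\max\{t,0\}$. Let $\mathcal{T}\subset\mathbb{C}$ be invariant under translation by $2\pi i$, such that every connected component $T$ of $\mathcal{T}$ (a *tract*) is a Jordan domain (a domain whose boundary in the Riemann sphere is a Jordan curve) on which $\exp$ is injective and the real parts are bounded below but unbounded above. Suppose that distinct tracts have disjoint closures in $\mathbb{C}$, and that $z_n\to\infty$ whenever $z_n$ are points in pairwise different tracts. Let $F:\mathcal{T}\to\mathbb{H}$ map every tract conformally and bijectively onto $\mathbb{H}$, extend continuously to a map $F:\overline{\mathcal{T}}\to\mathbb{C}$ on the closure of $\mathcal{T}$ in $\mathbb{C}$, and satisfy $|F'(z)|\ge 2$ for all $z\in\mathcal{T}$. (That is, $F$ is a normalized function of class $\mathcal{B}_{\log}$.) Suppose that the tracts have bounded slope with constants $\alpha,\beta>0$: $$|\operatorname{Im} z-\operatorname{Im} w|\le\alpha\max\{\operatorname{Re} z,\operatorname{Re} w,0\}+\beta\quad\text{whenever $z,w$ belong to a common tract.}$$ Let $K>1$. Then the following are equivalent. (i) For some $M>0$, $F$ satisfies the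 uniform linear head-start condition with constants $K$ and $M$, i.e. with $\phi(t)=Kt^++M$, every sequence $\underline{s}=T_0T_1T_2\dots$ of tracts has the following two properties. First, for all $k\geq 0$ and all $z,w\in\overline{T_k}$ with $F(z),F(w)\in\overline{T_{k+1}}$, if $\operatorname{Re} w>\phi(\operatorname{Re} z)$ then $\operatorname{Re} F(w)>\phi(\operatorname{Re} F(z))$. Second, if $z\ne w$ are points such that, for all $n\ge0$, $F^{\circ n}(z)$ and $F^{\circ n}(w)$ are defined and belong to $\overline{T_n}$, then there is $m\ge0$ with $\operatorname{Re} F^{\circ m}(z)>\phi(\operatorname{Re} F^{\circ m}(w))$ or $\operatorname{Re} F^{\circ m}(w)>\phi(\operatorname{Re} F^{\circ m}(z))$. (ii) For some $\mu>0$, the tracts of $F$ have uniformly bounded wiggling with constants $K$ and $\mu$: for every tract $T$ and every $z_0\in\overline{T}$, every point $z$ on the hyperbolic geodesic of $T$ that connects $z_0$ to $\infty$ satisfies $(\operatorname{Re} z)^+>\frac1K\operatorname{Re} z_0-\mu$. (iii) For some $M>0$ the following holds. If $T$ is a tract of $F$ and $z,w\in\overline{T}$ satisfy $\operatorname{Re}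 w>K(\operatorname{Re} z)^++M$ and $|\operatorname{Im} F(z)-\operatorname{Im} F(w)|\le\alpha\max\{\operatorname{Re} F(z),\operatorname{Re} F(w)\}+\beta$, then $\operatorname{Re} F(w)>K\operatorname{Re} F(z)+M$. -/

import Mathlib

open Set Filter Topology

/-- The open right half plane. -/
def rightHalfPlane : Set ℂ := {z | 0 < z.re}

/-- A Jordan domain: a plane domain whose boundary in the Riemann sphere `ℂ ∪ {∞}` is a Jordan
curve, i.e. the image of a continuous injective map of the circle. -/
def IsJordanDomain (U : Set ℂ) : Prop :=
  IsOpen U ∧ IsConnected U ∧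
    ∃ γ : Circle → OnePoint ℂ, Continuous γ ∧ Function.Injective γ ∧
      frontier (((↑) : ℂ → OnePoint ℂ) '' U) = range γ

/-- `f` is a conformal isomorphism (a holomorphic bijection) from the domain `U` onto `V`. -/
def IsConformalIso (f : ℂ → ℂ) (U V : Set ℂ) : Prop :=
  DifferentiableOn ℂ f U ∧ BijOn f U V

/-- The tracts: the connected components of the domain of definition. -/
def tracts (D : Set ℂ) : Set (Set ℂ) :=
  {T | ∃ z ∈ D, T = connectedComponentIn D z}

/-- `F : D → H` belongs to the class `B_log`. The function `F` stands for the map `D → H`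
together with its continuous extension to the closure of `D` in the plane (its values outside
that closure are irrelevant and never used). -/
structure IsBlog (D H : Set ℂ) (F : ℂ → ℂ) : Prop where
  jordan_codomain : IsJordanDomain H
  periodic_codomain : ∀ z : ℂ, z + 2 * Real.pi * Complex.I ∈ H ↔ z ∈ H
  halfPlane_subset : ∃ R : ℝ, {z : ℂ | R < z.re} ⊆ H
  jordan_tract : ∀ T ∈ tracts D, IsJordanDomain T
  re_bddBelow : ∀ T ∈ tracts D, BddBelow (Complex.re '' T)
  re_not_bddAbove : ∀ T ∈ tracts D, ¬ BddAbove (Complex.re '' T)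
  disjoint_closure : ∀ T ∈ tracts D, ∀ T' ∈ tracts D, T ≠ T' →
    Disjoint (closure T) (closure T')
  /-- The tracts accumulate only at infinity. -/
  accumulate : ∀ (T : ℕ → Set ℂ) (z : ℕ → ℂ), (∀ n, T n ∈ tracts D) → Function.Injective T →
    (∀ n, z n ∈ T n) → Tendsto z atTop (cocompact ℂ)
  conformal : ∀ T ∈ tracts D, IsConformalIso F T H
  continuous_closure : ContinuousOn F (closure D)
  injOn_exp : ∀ T ∈ tracts D, InjOn Complex.exp T
  periodic_domain : ∀ z : ℂ, z + 2 * Real.pi * Complex.I ∈ D ↔ z ∈ D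

/-- `F : D → ℍ` is a normalized function of class `B_log`: the codomain is the right half plane
and `F` is expanding. -/
structure IsNormalizedBlog (D : Set ℂ) (F : ℂ → ℂ) : Prop where
  isBlog : IsBlog D rightHalfPlane F
  expanding : ∀ z ∈ D, 2 ≤ ‖deriv F z‖

/-- The tracts have bounded slope with constants `α` and `β`. -/
def HasBoundedSlope (D : Set ℂ) (α β : ℝ) : Prop :=
  ∀ T ∈ tracts D, ∀ z ∈ T, ∀ w ∈ T, |z.im - w.im| ≤ α * max (max z.re w.re) 0 + β

/-- The Julia set of `F`. -/
def juliaSet (D : Set ℂ) (F : ℂ → ℂ) : Set ℂ :=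
  {z | ∀ n : ℕ, F^[n] z ∈ closure D}

/-- An external address: a sequence of tracts. -/
def IsExternalAddress (D : Set ℂ) (s : ℕ → Set ℂ) : Prop :=
  ∀ n, s n ∈ tracts D

/-- The points of the Julia set with external address `s`. -/
def juliaAddress (D : Set ℂ) (F : ℂ → ℂ) (s : ℕ → Set ℂ) : Set ℂ :=
  {z ∈ juliaSet D F | ∀ n : ℕ, F^[n] z ∈ closure (s n)}

/-- The functions that are admissible in a head-start condition. -/
def IsHeadStartFunction (φ : ℝ → ℝ) : Prop :=
  Monotone φ ∧ Continuous φ ∧ ∀ x, x < φ x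

/-- The pair of tracts `(T, T')` satisfies the head-start condition for `φ`. -/
def PairHeadStart (F : ℂ → ℂ) (φ : ℝ → ℝ) (T T' : Set ℂ) : Prop :=
  ∀ z ∈ closure T, ∀ w ∈ closure T, F z ∈ closure T' → F w ∈ closure T' →
    φ z.re < w.re → φ (F z).re < (F w).re

/-- The external address `s` satisfies the head-start condition for `φ`. -/
def AddressHeadStart (D : Set ℂ) (F : ℂ → ℂ) (φ : ℝ → ℝ) (s : ℕ → Set ℂ) : Prop :=
  (∀ k : ℕ, PairHeadStart F φ (s k) (s (k + 1))) ∧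
    ∀ z ∈ juliaAddress D F s, ∀ w ∈ juliaAddress D F s, z ≠ w →
      ∃ m : ℕ, φ (F^[m] w).re < (F^[m] z).re ∨ φ (F^[m] z).re < (F^[m] w).re

/-- `F` satisfies the uniform head-start condition for `φ`. -/
def UniformHeadStart (D : Set ℂ) (F : ℂ → ℂ) (φ : ℝ → ℝ) : Prop :=
  IsHeadStartFunction φ ∧ ∀ s, IsExternalAddress D s → AddressHeadStart D F φ s

/-- `F` satisfies the uniform linear head-start condition with constants `K` and `M`. -/
def UniformLinearHeadStart (D : Set ℂ) (F : ℂ → ℂ) (K M : ℝ) : Prop :=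
  UniformHeadStart D F (fun t => K * max t 0 + M)

/-- `G` is (the set of points in `T` of) a hyperbolic geodesic of the simply connected domain `T`
that connects `z₀ ∈ closure T` to `∞`. The hyperbolic metric of `T` is transported from the
Poincaré metric of the upper half plane by a Riemann map `f`, so the unit speed geodesics of `T`
are the curves `f ∘ σ` with `σ` isometric. If `z₀` is a point of `T` this is a geodesic ray
from `z₀` to `∞`; if `z₀` is a boundary point, it is a complete geodesic line whose two ends
converge to `z₀` and to `∞`. -/
def IsGeodesicToInfinity (T : Set ℂ) (z₀ : ℂ) (G : Set ℂ) : Prop :=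
  ∃ f : ℂ → ℂ, IsConformalIso f UpperHalfPlane.upperHalfPlaneSet T ∧
    ((z₀ ∈ T ∧ ∃ σ : ℝ → UpperHalfPlane,
        (∀ s ∈ Ici (0 : ℝ), ∀ t ∈ Ici (0 : ℝ), dist (σ s) (σ t) = |s - t|) ∧
        f (σ 0) = z₀ ∧
        Tendsto (fun t => f (σ t)) atTop (cocompact ℂ) ∧
        G = (fun t => f (σ t)) '' Ici (0 : ℝ)) ∨
      (z₀ ∈ frontier T ∧ ∃ σ : ℝ → UpperHalfPlane,
        (∀ s t : ℝ, dist (σ s) (σ t) = |s - t|) ∧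
        Tendsto (fun t => f (σ t)) atBot (𝓝 z₀) ∧
        Tendsto (fun t => f (σ t)) atTop (cocompact ℂ) ∧
        G = range (fun t => f (σ t))))

/-- The wiggling of the tract `T` is bounded by the constants `K` and `μ`. -/
def HasBoundedWiggling (T : Set ℂ) (K μ : ℝ) : Prop :=
  ∀ z₀ ∈ closure T, ∀ G, IsGeodesicToInfinity T z₀ G →
    ∀ z ∈ G, 1 / K * z₀.re - μ < max z.re 0

/-- The tracts have uniformly bounded wiggling with constants `K` and `μ`. -/
def UniformlyBoundedWiggling (D : Set ℂ) (K μ : ℝ) : Prop :=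
  ∀ T ∈ tracts D, HasBoundedWiggling T K μ

/-- The strengthened linear head-start inequality with constants `K` and `M`, for maps with
slope constants `α` and `β`. -/
def StrongLinearHeadStart (D : Set ℂ) (F : ℂ → ℂ) (α β K M : ℝ) : Prop :=
  ∀ T ∈ tracts D, ∀ z ∈ closure T, ∀ w ∈ closure T,
    K * max z.re 0 + M < w.re →
    |(F z).im - (F w).im| ≤ α * max (F z).re (F w).re + β →
    K * (F z).re + M < (F w).re

/-! On a tract `T`, let `G : ℍ → T` be the inverse of `F`. Two contraction estimates carry the
proof. Expansion gives `|G'| ≤ 1/2`. Since `exp` is injective on `T`, no disc in `T` has radius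
above `π`, so a Bloch-type theorem gives `|G'(ζ)| ≤ 96π / Re ζ`. Hence a displacement of `F z`
comparable to its height, after a bounded shift to the right, moves `z` only a bounded distance
(`IsTractInverse.norm_sub_inv_le_add`). By Schwarz–Pick, `F` carries hyperbolic geodesics of `T` to
those of `ℍ`; the ones ending at `∞` are the horizontal rays and lines. So wiggling compares `Re z₀`
with `Re z` when `F z` lies to the right of `F z₀` on the same horizontal ray. (i) ⇒ (ii): replace
`F z₀` and `F z` by points of nearly the same real parts in one tract `T'`, a suitable
`2πi`-translate of a fixed tract. Their preimages stay near `z₀` and `z`, and the head-start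
condition for `(T, T')` bounds the wiggling. (ii) ⇒ (iii): if the conclusion fails, a point far
enough along the geodesic of `w` is close to `z`, and wiggling bounds `Re w` by `K (Re z)⁺ + M`.
(iii) ⇒ (i): bounded slope in the next tract supplies the hypothesis on imaginary parts. If neither
orbit ever gets ahead, the orbits stay at bounded distance, which expansion forbids. -/

/-! ### Holomorphic inverses and a Bloch-type covering theorem. -/

/-- A holomorphic injection of an open set has a holomorphic inverse. -/
theorem differentiableOn_invFunOn {f : ℂ → ℂ} {U : Set ℂ} (hU : IsOpen U)
    (hf : DifferentiableOn ℂ f U) (hinj : InjOn f U) :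
    DifferentiableOn ℂ (Function.invFunOn f U) (f '' U) := by
  set g := Function.invFunOn f U
  have hgf : ∀ z ∈ U, g (f z) = z := fun z hz => hinj.leftInvOn_invFunOn hz
  have hmap : ∀ z ∈ U, 𝓝 (f z) ≤ map f (𝓝 z) := by
    intro z hz
    refine (hf.analyticAt (hU.mem_nhds hz)).eventually_constant_or_nhds_le_map_nhds.resolve_left ?_
    intro h
    obtain ⟨r, hr, hr'⟩ := Metric.eventually_nhds_iff.1 (h.and (hU.mem_nhds hz))
    have hx : dist (z + (r / 2 : ℝ)) z < r := by
      rw [dist_eq_norm, add_sub_cancel_left, Complex.norm_real, Real.norm_of_nonneg (by positivity)]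
      linarith
    have := hinj (hr' hx).2 hz (hr' hx).1
    have h2 : ((r / 2 : ℝ) : ℂ) = 0 := by linear_combination this
    rw [Complex.ofReal_eq_zero] at h2
    linarith
  have himage : ∀ z ∈ U, ∀ᶠ v in 𝓝 (f z), v ∈ f '' U := fun z hz =>
    hmap z hz (mem_map.2 (mem_of_superset (hU.mem_nhds hz) (subset_preimage_image f U)))
  have hcont : ∀ z ∈ U, ContinuousAt g (f z) := by
    intro z hz
    rw [ContinuousAt, hgf z hz]
    refine Tendsto.mono_left ?_ (hmap z hz)
    rw [tendsto_map'_iff]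
    refine tendsto_id.congr' ?_
    filter_upwards [hU.mem_nhds hz] with x hx using (hgf x hx).symm
  have hright : ∀ z ∈ U, ∀ᶠ v in 𝓝 (f z), f (g v) = v := fun z hz => by
    filter_upwards [himage z hz] with v ⟨x, hx, hxv⟩
    rw [← hxv, hgf x hx]
  have hderiv : ∀ z ∈ U, deriv f z ≠ 0 → DifferentiableAt ℂ g (f z) := by
    intro z hz h0
    have hd : HasDerivAt f (deriv f z) (g (f z)) := by
      rw [hgf z hz]
      exact (hf.differentiableAt (hU.mem_nhds hz)).hasDerivAt
    exact (HasDerivAt.of_local_left_inverse (hcont z hz) hd h0 (hright z hz)).differentiableAt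
  rintro _ ⟨z, hz, rfl⟩
  refine DifferentiableAt.differentiableWithinAt ?_
  have han : AnalyticAt ℂ (deriv f) z := (hf.analyticAt (hU.mem_nhds hz)).deriv
  -- If `f'` vanishes near `z`, then `f` is locally constant, against injectivity. Otherwise
  -- critical points are isolated, and `g`, continuous at `f z` and holomorphic on a punctured
  -- neighbourhood, has a removable singularity there.
  rcases han.eventually_eq_zero_or_eventually_ne_zero with h | h
  · exfalso
    obtain ⟨r, hr, hr'⟩ := Metric.eventually_nhds_iff_ball.1 (h.and (hU.mem_nhds hz))
    have hsub : Metric.ball z r ⊆ U := fun x hx => (hr' x hx).2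
    have hx : z + (r / 2 : ℝ) ∈ Metric.ball z r := by
      rw [Metric.mem_ball, dist_eq_norm, add_sub_cancel_left, Complex.norm_real,
        Real.norm_of_nonneg (by positivity)]
      linarith
    have hconst := (convex_ball z r).norm_image_sub_le_of_norm_deriv_le (𝕜 := ℂ) (f := f) (C := 0)
      (fun x hx => hf.differentiableAt (hU.mem_nhds (hsub hx)))
      (fun x hx => by rw [(hr' x hx).1, norm_zero]) (Metric.mem_ball_self hr) hx
    rw [zero_mul, norm_le_zero_iff, sub_eq_zero] at hconst
    have := hinj (hsub hx) hz hconst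
    have h2 : ((r / 2 : ℝ) : ℂ) = 0 := by linear_combination this
    rw [Complex.ofReal_eq_zero] at h2
    linarith
  · have hev : ∀ᶠ v in 𝓝[≠] (f z), DifferentiableAt ℂ g v := by
      have h1 : ∀ᶠ x in 𝓝 z, x ≠ z → deriv f x ≠ 0 := eventually_nhdsWithin_iff.1 h
      have h2 := (hcont z hz).tendsto
      rw [hgf z hz] at h2
      rw [eventually_nhdsWithin_iff]
      filter_upwards [h2.eventually h1, himage z hz] with v hv ⟨x, hx, hxv⟩ hne
      rw [← hxv] at hv ⊢
      rw [hgf x hx] at hv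
      refine hderiv x hx (hv ?_)
      rintro rfl
      exact hne hxv.symm
    rw [eventually_nhdsWithin_iff] at hev
    obtain ⟨s, hs, hso, hzs⟩ := eventually_nhds_iff.1 hev
    exact ((Complex.differentiableOn_compl_singleton_and_continuousAt_iff (hso.mem_nhds hzs)).1
      ⟨fun v hv => (hs v hv.1 hv.2).differentiableWithinAt, hcont z hz⟩).differentiableAt
      (hso.mem_nhds hzs)

theorem IsConformalIso.exists_inverse {f : ℂ → ℂ} {U V : Set ℂ} (hU : IsOpen U)
    (hf : IsConformalIso f U V) :
    ∃ g : ℂ → ℂ, IsConformalIso g V U ∧ (∀ z ∈ U, g (f z) = z) ∧ ∀ v ∈ V, f (g v) = v := by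
  obtain ⟨hd, hb⟩ := hf
  have hinv := hb.invOn_invFunOn
  refine ⟨Function.invFunOn f U, ⟨?_, hb.symm hinv.symm⟩,
    fun z hz => hinv.1 hz, fun v hv => hinv.2 hv⟩
  rw [← hb.image_eq]
  exact differentiableOn_invFunOn hU hd hb.injOn

/-- A weak form of Bloch's theorem. -/
theorem exists_ball_subset_image {f : ℂ → ℂ} {U : Set ℂ} {c : ℂ} {R : ℝ} (hU : IsOpen U)
    (hf : DifferentiableOn ℂ f U) (hR : 0 < R) (hsub : Metric.closedBall c R ⊆ U) :
    ∃ b, Metric.ball b (R * ‖deriv f c‖ / 48) ⊆ f '' U := by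
  rcases eq_or_ne (deriv f c) 0 with h0 | h0
  · exact ⟨0, by simp [h0]⟩
  have hdc : DifferentiableOn ℂ (deriv f) U := hf.deriv hU
  -- Landau's device: at a maximum `a` of `(R - |z - c|) |f' z|`, the derivative is at most `2 |f'
  -- a|` on the disc about `a` of half the distance to the boundary circle.
  obtain ⟨a, ha, hmax⟩ := (isCompact_closedBall c R).exists_isMaxOn
    ⟨c, Metric.mem_closedBall_self hR.le⟩
    (f := fun z => (R - dist z c) * ‖deriv f z‖)
    (((continuous_const.sub (continuous_id.dist continuous_const)).continuousOn).mul
      ((hdc.continuousOn.mono hsub).norm))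
  have hmax' : ∀ z ∈ Metric.closedBall c R,
      (R - dist z c) * ‖deriv f z‖ ≤ (R - dist a c) * ‖deriv f a‖ := fun z hz => hmax hz
  have hc := hmax' c (Metric.mem_closedBall_self hR.le)
  rw [dist_self, sub_zero] at hc
  have hpos : 0 < (R - dist a c) * ‖deriv f a‖ :=
    lt_of_lt_of_le (mul_pos hR (norm_pos_iff.2 h0)) hc
  have ha' : 0 ≤ R - dist a c := sub_nonneg.2 ha
  have hA : 0 < ‖deriv f a‖ := pos_of_mul_pos_right hpos ha'
  have hδ : 0 < R - dist a c := pos_of_mul_pos_left hpos hA.le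
  obtain ⟨δ, hδdef⟩ : ∃ δ, δ = (R - dist a c) / 2 := ⟨_, rfl⟩
  have hδ0 : 0 < δ := by rw [hδdef]; positivity
  have hballsub : Metric.ball a δ ⊆ Metric.closedBall c R := by
    intro z hz
    have h1 := dist_triangle z a c
    rw [Metric.mem_ball] at hz
    rw [Metric.mem_closedBall]
    linarith
  have hbound : ∀ z ∈ Metric.ball a δ, ‖deriv f z‖ ≤ 2 * ‖deriv f a‖ := by
    intro z hz
    have h2 := hmax' z (hballsub hz)
    have h1 := dist_triangle z a c
    rw [Metric.mem_ball] at hz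
    have h3 : δ * ‖deriv f z‖ ≤ (R - dist z c) * ‖deriv f z‖ :=
      mul_le_mul_of_nonneg_right (by linarith) (norm_nonneg _)
    have h4 : δ * ‖deriv f z‖ ≤ δ * (2 * ‖deriv f a‖) := by
      have : (R - dist a c) = 2 * δ := by linarith
      rw [this] at h2
      linarith
    exact le_of_mul_le_mul_left h4 hδ0
  have hmaps : MapsTo (deriv f) (Metric.ball a δ)
      (Metric.closedBall (deriv f a) (3 * ‖deriv f a‖)) := by
    intro z hz
    rw [mem_closedBall_iff_norm]
    have := norm_sub_le (deriv f z) (deriv f a)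
    have := hbound z hz
    linarith
  have hsmall : Metric.closedBall a (δ / 6) ⊆ Metric.ball a δ :=
    Metric.closedBall_subset_ball (by linarith)
  -- The Schwarz lemma for `f'` makes `f` nearly linear on a disc of radius `δ / 6`, so `f` moves
  -- its boundary circle away from `f a` by at least `|f' a| δ / 12`.
  have hnear : ∀ z ∈ Metric.closedBall a (δ / 6), ‖deriv f z - deriv f a‖ ≤ ‖deriv f a‖ / 2 := by
    intro z hz
    have h1 := Complex.dist_le_div_mul_dist_of_mapsTo_ball
      (hdc.mono (hballsub.trans hsub)) hmaps (hsmall hz)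
    rw [dist_eq_norm] at h1
    rw [Metric.mem_closedBall] at hz
    calc ‖deriv f z - deriv f a‖ ≤ 3 * ‖deriv f a‖ / δ * dist z a := h1
      _ ≤ 3 * ‖deriv f a‖ / δ * (δ / 6) := by gcongr
      _ = ‖deriv f a‖ / 2 := by field_simp; norm_num
  have hdiff : ∀ z ∈ Metric.closedBall a (δ / 6), DifferentiableAt ℂ f z := fun z hz =>
    hf.differentiableAt (hU.mem_nhds (hsub (hballsub (hsmall hz))))
  have hlow : ∀ z ∈ Metric.sphere a (δ / 6), ‖deriv f a‖ * δ / 12 ≤ ‖f z - f a‖ := by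
    intro z hz
    have hd : ∀ x ∈ Metric.closedBall a (δ / 6),
        HasDerivAt (fun x => f x - deriv f a * x) (deriv f x - deriv f a) x := fun x hx => by
      have h := (hasDerivAt_id x).const_mul (deriv f a)
      rw [mul_one] at h
      exact (hdiff x hx).hasDerivAt.sub h
    have h1 := (convex_closedBall a (δ / 6)).norm_image_sub_le_of_norm_deriv_le
      (f := fun x => f x - deriv f a * x) (fun x hx => (hd x hx).differentiableAt)
      (fun x hx => by rw [(hd x hx).deriv]; exact hnear x hx)
      (Metric.mem_closedBall_self (by positivity)) (Metric.sphere_subset_closedBall hz)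
    have hza : ‖z - a‖ = δ / 6 := mem_sphere_iff_norm.1 hz
    have h2 : ‖deriv f a * (z - a)‖ = ‖deriv f a‖ * (δ / 6) := by rw [norm_mul, hza]
    have h3 := norm_sub_norm_le (deriv f a * (z - a)) (-(f z - deriv f a * z - (f a - deriv f a * a)))
    have h4 : deriv f a * (z - a) - -(f z - deriv f a * z - (f a - deriv f a * a)) = f z - f a := by
      ring
    rw [h4, norm_neg, h2] at h3
    rw [hza] at h1
    linarith
  have hfreq : ∃ᶠ z in 𝓝 a, f z ≠ f a := by
    have := ((hdiff a (Metric.mem_closedBall_self (by positivity))).hasDerivAt.eventually_ne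
      (c := f a) (norm_pos_iff.1 hA)).frequently
    exact this.filter_mono nhdsWithin_le_nhds
  have hdcc : DiffContOnCl ℂ f (Metric.ball a (δ / 6)) := by
    refine DifferentiableOn.diffContOnCl fun z hz => ?_
    rw [closure_ball _ (by positivity)] at hz
    exact (hdiff z hz).differentiableWithinAt
  -- The covering lemma halves the radius to `|f' a| δ / 24`; maximality gives `R |f' c| ≤ 2 δ |f'
  -- a|`, whence `48`.
  refine ⟨f a, (Metric.ball_subset_ball ?_).trans
    ((hdcc.ball_subset_image_closedBall (by positivity) hlow hfreq).trans
      (image_mono (hsmall.trans (hballsub.trans hsub))))⟩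
  have : (R - dist a c) = 2 * δ := by linarith
  rw [this] at hc
  linarith

/-! ### Schwarz–Pick and geodesic rays in the upper half plane. -/

/-- The map `u ↦ (u - p) / (u - conj p)` takes the upper half plane to the unit disc. -/
theorem norm_sub_div_sub_conj_lt_one {u p : ℂ} (hu : 0 < u.im) (hp : 0 < p.im) :
    ‖(u - p) / (u - (starRingEnd ℂ) p)‖ < 1 := by
  have hne : 0 < ‖u - (starRingEnd ℂ) p‖ := by
    rw [norm_pos_iff]
    intro h
    have := congrArg Complex.im h
    simp at this
    linarith
  rw [norm_div, div_lt_one hne]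
  rw [← sq_lt_sq₀ (norm_nonneg _) hne.le, ← Complex.normSq_eq_norm_sq, ← Complex.normSq_eq_norm_sq,
    Complex.normSq_apply, Complex.normSq_apply]
  simp
  nlinarith [mul_pos hu hp]

/-- The **Schwarz-Pick lemma** for the upper half plane. -/
theorem UpperHalfPlane.dist_le_dist_of_mapsTo {h : ℂ → ℂ}
    (hd : DifferentiableOn ℂ h UpperHalfPlane.upperHalfPlaneSet)
    (hm : MapsTo h UpperHalfPlane.upperHalfPlaneSet UpperHalfPlane.upperHalfPlaneSet)
    {z w z' w' : UpperHalfPlane} (hz : h z = z') (hw : h w = w') : dist z' w' ≤ dist z w := by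
  -- Cayley map of the disc with `0 ↦ w`. It reduces the claim to the Schwarz lemma at `0`, since
  -- `tanh (d / 2)` is the modulus of the disc coordinate.
  set c : ℂ → ℂ := fun ζ => (w - (starRingEnd ℂ) w * ζ) / (1 - ζ)
  have hone : ∀ ζ ∈ Metric.ball (0 : ℂ) 1, 1 - ζ ≠ 0 := by
    intro ζ hζ h0
    rw [mem_ball_zero_iff, ← sub_eq_zero.1 h0, norm_one] at hζ
    exact lt_irrefl _ hζ
  have hc : MapsTo c (Metric.ball 0 1) UpperHalfPlane.upperHalfPlaneSet := by
    intro ζ hζ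
    have h1 : 0 < Complex.normSq (1 - ζ) := Complex.normSq_pos.2 (hone ζ hζ)
    have h2 : ζ.re * ζ.re + ζ.im * ζ.im < 1 := by
      rw [← Complex.normSq_apply, Complex.normSq_eq_norm_sq]
      rw [mem_ball_zero_iff] at hζ
      nlinarith [norm_nonneg ζ]
    have h3 : (c ζ).im = (w : ℂ).im * (1 - (ζ.re * ζ.re + ζ.im * ζ.im)) /
        Complex.normSq (1 - ζ) := by
      simp only [c, Complex.div_im, Complex.sub_im, Complex.mul_im, Complex.sub_re, Complex.mul_re,
        Complex.conj_re, Complex.conj_im, Complex.one_re, Complex.one_im]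
      ring
    change 0 < (c ζ).im
    rw [h3]
    exact div_pos (mul_pos w.im_pos (by linarith)) h1
  have hcd : DifferentiableOn ℂ c (Metric.ball 0 1) := by
    intro ζ hζ
    have := hone ζ hζ
    exact DifferentiableAt.differentiableWithinAt (by fun_prop (disch := assumption))
  have hne : ∀ u v : ℂ, 0 < u.im → 0 < v.im → u - (starRingEnd ℂ) v ≠ 0 := by
    intro u v hu hv h0
    have := congrArg Complex.im h0
    simp at this
    linarith
  set g : ℂ → ℂ := fun ζ => (h (c ζ) - w') / (h (c ζ) - (starRingEnd ℂ) w')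
  have hhc : DifferentiableOn ℂ (fun ζ => h (c ζ)) (Metric.ball 0 1) := hd.comp hcd hc
  have hgd : DifferentiableOn ℂ g (Metric.ball 0 1) :=
    (hhc.sub_const _).div (hhc.sub_const _) fun ζ hζ => hne _ _ (hm (hc hζ)) w'.im_pos
  have hg0 : g 0 = 0 := by simp [g, c, hw]
  have hgm : MapsTo g (Metric.ball 0 1) (Metric.closedBall 0 1) := fun ζ hζ => by
    rw [mem_closedBall_zero_iff]
    exact (norm_sub_div_sub_conj_lt_one (hm (hc hζ)) w'.im_pos).le
  have hζ := norm_sub_div_sub_conj_lt_one z.im_pos w.im_pos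
  set ζ : ℂ := ((z : ℂ) - w) / (z - (starRingEnd ℂ) w)
  have hcz : c ζ = z := by
    have h1 := hne z w z.im_pos w.im_pos
    have h2 := hone ζ (mem_ball_zero_iff.2 hζ)
    simp only [c]
    rw [div_eq_iff h2]
    have h3 : ζ * (z - (starRingEnd ℂ) w) = z - w := div_mul_cancel₀ _ h1
    linear_combination h3
  have key := Complex.norm_le_norm_of_mapsTo_ball hgd hgm hg0 hζ
  simp only [g, hcz, hz, ζ, norm_div] at key
  rw [← dist_eq_norm, ← dist_eq_norm, ← dist_eq_norm, ← dist_eq_norm,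
    ← UpperHalfPlane.tanh_half_dist, ← UpperHalfPlane.tanh_half_dist] at key
  by_contra! hlt
  rw [Real.tanh_eq_sinh_div_cosh, Real.tanh_eq_sinh_div_cosh,
    div_le_div_iff₀ (Real.cosh_pos _) (Real.cosh_pos _)] at key
  have h1 : 0 < Real.sinh (dist z' w' / 2 - dist z w / 2) := Real.sinh_pos_iff.2 (by linarith)
  rw [Real.sinh_sub] at h1
  linarith

theorem tendsto_dist_div_norm {ι : Type*} {l : Filter ι} {x : ι → ℂ} (p : ℂ)
    (hx : Tendsto (fun i => ‖x i‖) l atTop) :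
    Tendsto (fun i => dist p (x i) / ‖x i‖) l (𝓝 1) := by
  rw [tendsto_iff_norm_sub_tendsto_zero]
  refine squeeze_zero' (Eventually.of_forall fun _ => norm_nonneg _) ?_
    ((tendsto_const_nhds (x := ‖p‖)).div_atTop hx)
  filter_upwards [hx.eventually_gt_atTop 0] with i hi
  rw [div_sub_one hi.ne', norm_div, norm_norm, dist_comm, dist_eq_norm]
  gcongr
  rw [Real.norm_eq_abs]
  simpa using abs_norm_sub_norm_le (x i - p) (x i)

theorem tendsto_cosh_sub_one_mul_exp_neg (s : ℝ) :
    Tendsto (fun u => (Real.cosh (u - s) - 1) * Real.exp (-u)) atTop (𝓝 (Real.exp (-s) / 2)) := by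
  have h1 : Tendsto (fun u : ℝ => Real.exp (-u)) atTop (𝓝 0) :=
    Real.tendsto_exp_neg_atTop_nhds_zero
  have h2 : Tendsto (fun u : ℝ => Real.exp (-s) / 2 + Real.exp s / 2 * Real.exp (-u) ^ 2
      - Real.exp (-u)) atTop (𝓝 (Real.exp (-s) / 2 + Real.exp s / 2 * 0 ^ 2 - 0)) :=
    (tendsto_const_nhds.add (tendsto_const_nhds.mul (h1.pow 2))).sub h1
  simp only [ne_eq, OfNat.ofNat_ne_zero, not_false_eq_true, zero_pow, mul_zero, add_zero,
    sub_zero] at h2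
  refine h2.congr fun u => ?_
  rw [Real.cosh_eq, neg_sub, Real.exp_sub, Real.exp_sub, Real.exp_neg, Real.exp_neg]
  field_simp

/-- A geodesic ray of the upper half plane that tends to `∞` is vertical. -/
theorem UpperHalfPlane.vertical_of_isometric_ray {τ : ℝ → UpperHalfPlane}
    (hτ : ∀ s ∈ Ici (0 : ℝ), ∀ t ∈ Ici (0 : ℝ), dist (τ s) (τ t) = |s - t|)
    (hinf : Tendsto (fun t => ‖(τ t : ℂ)‖) atTop atTop) {s t : ℝ} (hs : 0 ≤ s) (hst : s ≤ t) :
    (τ t).re = (τ s).re ∧ (τ s).im ≤ (τ t).im := by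
  have hcosh : ∀ s u : ℝ, 0 ≤ s → s ≤ u → 2 * (τ s).im * (τ u).im * (Real.cosh (u - s) - 1) =
      dist (τ s : ℂ) (τ u) ^ 2 := by
    intro s u hs hu
    have h1 := UpperHalfPlane.cosh_dist (τ s) (τ u)
    rw [hτ s hs u (hs.trans hu), abs_sub_comm, abs_of_nonneg (sub_nonneg.2 hu)] at h1
    rw [h1]
    have := (τ s).im_pos.ne'
    have := (τ u).im_pos.ne'
    field_simp
    ring
  have hlim : ∀ s t : ℝ, Tendsto (fun u => (τ s).im * ((Real.cosh (u - s) - 1) * Real.exp (-u)) *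
      (dist (τ t : ℂ) (τ u) / ‖(τ u : ℂ)‖) ^ 2) atTop
      (𝓝 ((τ s).im * (Real.exp (-s) / 2) * 1 ^ 2)) := fun s t =>
    (tendsto_const_nhds.mul (tendsto_cosh_sub_one_mul_exp_neg s)).mul
      ((tendsto_dist_div_norm _ hinf).pow 2)
  -- The distances from `τ s` and from `τ t` to `τ u` are both asymptotic to `‖τ u‖`, so the
  -- cross-multiplied distance formulas agree in the limit. Heights thus grow exactly like `exp`,
  -- leaving no room for horizontal movement.
  have heq : (τ s).im * (Real.exp (-s) / 2) * 1 ^ 2 = (τ t).im * (Real.exp (-t) / 2) * 1 ^ 2 := by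
    refine tendsto_nhds_unique ((hlim s t).congr' ?_) (hlim t s)
    filter_upwards [eventually_ge_atTop t] with u hu
    rw [div_pow, div_pow, ← hcosh s u hs (hst.trans hu), ← hcosh t u (hs.trans hst) hu]
    ring
  have hexp : (τ t).im = (τ s).im * Real.exp (t - s) := by
    rw [Real.exp_sub]
    rw [Real.exp_neg, Real.exp_neg] at heq
    have h1 := Real.exp_pos s
    have h2 := Real.exp_pos t
    field_simp at heq ⊢
    linarith
  have hone : 1 ≤ Real.exp (t - s) := Real.one_le_exp (by linarith)
  refine ⟨?_, by rw [hexp]; exact le_mul_of_one_le_right (τ s).im_pos.le hone⟩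
  have h1 := hcosh s t hs hst
  rw [Complex.dist_eq_re_im, Real.sq_sqrt (by positivity), Real.cosh_eq, neg_sub] at h1
  have h3 : Real.exp (s - t) * Real.exp (t - s) = 1 := by rw [← Real.exp_add]; simp
  simp only [UpperHalfPlane.coe_re, UpperHalfPlane.coe_im] at h1
  rw [hexp] at h1
  have h4 : ((τ s).re - (τ t).re) ^ 2 = 0 := by
    linear_combination -h1 + (τ s).im ^ 2 * h3
  have h5 := pow_eq_zero_iff (two_ne_zero) |>.1 h4
  linarith

/-! ### The inverse branch on a tract: contraction and geodesics. -/

theorem isOpen_rightHalfPlane : IsOpen rightHalfPlane :=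
  isOpen_lt continuous_const Complex.continuous_re

theorem convex_rightHalfPlane : Convex ℝ rightHalfPlane :=
  convex_halfSpace_re_gt 0

/-- `G` is the inverse of the conformal map `F : T → ℍ`, where `F` extends continuously to the
closure of `T`; moreover `G` contracts distances by a factor `1 / 2`, and by a factor `C / L` on
the half plane at height `L`. -/
structure IsTractInverse (F G : ℂ → ℂ) (T : Set ℂ) (C : ℝ) : Prop where
  isOpen : IsOpen T
  differentiableOn : DifferentiableOn ℂ F T
  continuousOn : ContinuousOn F (closure T)
  mapsTo : MapsTo F T rightHalfPlane
  differentiableOn_inv : DifferentiableOn ℂ G rightHalfPlane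
  mapsTo_inv : MapsTo G rightHalfPlane T
  left_inv : ∀ z ∈ T, G (F z) = z
  right_inv : ∀ ζ ∈ rightHalfPlane, F (G ζ) = ζ
  norm_sub_le_half : ∀ ζ ∈ rightHalfPlane, ∀ ω ∈ rightHalfPlane, ‖G ζ - G ω‖ ≤ ‖ζ - ω‖ / 2
  norm_sub_le_div : ∀ L : ℝ, 0 < L → ∀ ζ ω : ℂ, L ≤ ζ.re → L ≤ ω.re →
    ‖G ζ - G ω‖ ≤ C * (‖ζ - ω‖ / L)

/-- A domain on which the exponential map is injective contains no disc of radius greater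
than `π`. -/
theorem le_pi_of_ball_subset {T : Set ℂ} (hT : InjOn Complex.exp T) {b : ℂ} {r : ℝ}
    (h : Metric.ball b r ⊆ T) : r ≤ Real.pi := by
  by_contra! hr
  have hnorm : ‖(Real.pi : ℂ) * Complex.I‖ = Real.pi := by
    rw [norm_mul, Complex.norm_I, mul_one, Complex.norm_real,
      Real.norm_of_nonneg Real.pi_pos.le]
  have h1 : b + Real.pi * Complex.I ∈ T := h (by
    rw [Metric.mem_ball, dist_eq_norm, add_sub_cancel_left, hnorm]; exact hr)
  have h2 : b - Real.pi * Complex.I ∈ T := h (by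
    rw [Metric.mem_ball, dist_eq_norm, sub_sub_cancel_left, norm_neg, hnorm]; exact hr)
  have h3 := hT h1 h2 (by
    rw [show b + Real.pi * Complex.I = b - Real.pi * Complex.I + 2 * Real.pi * Complex.I by ring,
      Complex.exp_add, Complex.exp_two_pi_mul_I, mul_one])
  have h4 : (Real.pi : ℂ) * Complex.I = 0 := by linear_combination h3 / 2
  rw [h4, norm_zero] at hnorm
  exact Real.pi_pos.ne hnorm

theorem IsNormalizedBlog.exists_inverse {D : Set ℂ} {F : ℂ → ℂ} (hF : IsNormalizedBlog D F)
    {T : Set ℂ} (hT : T ∈ tracts D) : ∃ G, IsTractInverse F G T (96 * Real.pi) := by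
  have hB := hF.isBlog
  have hTo : IsOpen T := (hB.jordan_tract T hT).1
  have hTD : T ⊆ D := by
    obtain ⟨z, -, rfl⟩ := hT
    exact connectedComponentIn_subset D z
  have hc := hB.conformal T hT
  obtain ⟨G, ⟨hGd, hGb⟩, hl, hr⟩ := hc.exists_inverse hTo
  have hHo := isOpen_rightHalfPlane
  have hGda : ∀ ζ ∈ rightHalfPlane, DifferentiableAt ℂ G ζ := fun ζ hζ =>
    hGd.differentiableAt (hHo.mem_nhds hζ)
  have hhalf : ∀ ζ ∈ rightHalfPlane, ‖deriv G ζ‖ ≤ 1 / 2 := by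
    intro ζ hζ
    have h1 := (hc.1.differentiableAt (hTo.mem_nhds (hGb.mapsTo hζ))).hasDerivAt.comp ζ
      (hGda ζ hζ).hasDerivAt
    have h2 : HasDerivAt (F ∘ G) 1 ζ := (hasDerivAt_id ζ).congr_of_eventuallyEq (by
      filter_upwards [hHo.mem_nhds hζ] with x hx using hr x hx)
    have h3 := congrArg norm (h1.unique h2)
    rw [norm_mul, norm_one] at h3
    have h4 := hF.expanding (G ζ) (hTD (hGb.mapsTo hζ))
    nlinarith [norm_nonneg (deriv G ζ)]
  -- Bloch on the disc of radius `Re ζ / 2` yields a disc of radius `|G' ζ| Re ζ / 96` in `T`, hence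
  -- at most `π`.
  have hbloch : ∀ ζ ∈ rightHalfPlane, ‖deriv G ζ‖ * ζ.re ≤ 96 * Real.pi := by
    intro ζ hζ
    have hζ' : 0 < ζ.re := hζ
    have hsub : Metric.closedBall ζ (ζ.re / 2) ⊆ rightHalfPlane := by
      intro x hx
      rw [mem_closedBall_iff_norm] at hx
      have h1 := (abs_le.1 ((Complex.abs_re_le_norm (x - ζ)).trans hx)).1
      rw [Complex.sub_re] at h1
      change 0 < x.re
      linarith
    obtain ⟨b, hb⟩ := exists_ball_subset_image hHo hGd (half_pos hζ') hsub
    rw [hGb.image_eq] at hb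
    have := le_pi_of_ball_subset (hB.injOn_exp T hT) hb
    linarith
  refine ⟨G, hTo, hc.1, hB.continuous_closure.mono (closure_mono hTD), hc.2.mapsTo, hGd,
    hGb.mapsTo, hl, hr, ?_, ?_⟩
  · intro ζ hζ ω hω
    have := convex_rightHalfPlane.norm_image_sub_le_of_norm_deriv_le (𝕜 := ℂ) hGda hhalf hω hζ
    linarith
  · intro L hL ζ ω hζ hω
    have hsub : ∀ x ∈ {x : ℂ | L ≤ x.re}, x ∈ rightHalfPlane := fun x hx =>
      lt_of_lt_of_le hL hx
    have := (convex_halfSpace_re_ge L).norm_image_sub_le_of_norm_deriv_le (𝕜 := ℂ)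
      (C := 96 * Real.pi / L)
      (fun x hx => hGda x (hsub x hx)) (fun x hx => by
        rw [le_div_iff₀ hL]
        exact (mul_le_mul_of_nonneg_left (mem_ofPred.1 hx) (norm_nonneg _)).trans (hbloch x (hsub x hx))) hω hζ
    refine this.trans_eq ?_
    ring

namespace IsTractInverse

variable {F G : ℂ → ℂ} {T : Set ℂ} {C : ℝ}

theorem re_nonneg (h : IsTractInverse F G T C) {z : ℂ} (hz : z ∈ closure T) : 0 ≤ (F z).re :=
  le_on_closure (f := fun _ => 0) (g := fun z => (F z).re) (fun _ hx => (h.mapsTo hx).le)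
    continuousOn_const (Complex.continuous_re.comp_continuousOn h.continuousOn) hz

theorem norm_sub_le (h : IsTractInverse F G T C) {z w : ℂ} (hz : z ∈ closure T)
    (hw : w ∈ closure T) : ‖z - w‖ ≤ ‖F z - F w‖ / 2 := by
  have hc : ContinuousOn (fun p : ℂ × ℂ => ‖F p.1 - F p.2‖ / 2) (closure T ×ˢ closure T) :=
    ((h.continuousOn.comp continuousOn_fst fun p hp => hp.1).sub
      (h.continuousOn.comp continuousOn_snd fun p hp => hp.2)).norm.div_const 2
  rw [← closure_prod_eq] at hc
  refine le_on_closure (s := T ×ˢ T) (f := fun p : ℂ × ℂ => ‖p.1 - p.2‖)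
    (fun p hp => ?_) (by fun_prop) hc (x := (z, w)) (by rw [closure_prod_eq]; exact ⟨hz, hw⟩)
  have := h.norm_sub_le_half _ (h.mapsTo hp.1) _ (h.mapsTo hp.2)
  rwa [h.left_inv _ hp.1, h.left_inv _ hp.2] at this

theorem norm_sub_inv_le (h : IsTractInverse F G T C) {z ζ : ℂ} (hz : z ∈ closure T)
    (hζ : ζ ∈ rightHalfPlane) : ‖z - G ζ‖ ≤ ‖F z - ζ‖ / 2 := by
  have := h.norm_sub_le hz (subset_closure (h.mapsTo_inv hζ))
  rwa [h.right_inv ζ hζ] at this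

/-- If `F z` is first shifted to the right by `t`, and then moved in a half plane at height `L`,
then `z` does not move far. -/
theorem norm_sub_inv_le_add (h : IsTractInverse F G T C) {z ζ : ℂ} (hz : z ∈ closure T)
    {t L : ℝ} (ht : 0 < t) (hL : 0 < L) (hzL : L ≤ (F z).re + t) (hζ : L ≤ ζ.re) :
    ‖z - G ζ‖ ≤ t / 2 + C * (‖F z + t - ζ‖ / L) := by
  have hre : (F z + t).re = (F z).re + t := by simp
  have h1 := h.norm_sub_inv_le hz (ζ := F z + t) (by
    change 0 < (F z + t).re
    linarith)
  have h2 := h.norm_sub_le_div L hL (F z + t) ζ (hzL.trans_eq hre.symm) hζ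
  have h3 : ‖F z - (F z + t)‖ = t := by
    rw [sub_add_cancel_left, norm_neg, Complex.norm_real, Real.norm_of_nonneg ht.le]
  have h4 := norm_add_le (z - G (F z + t)) (G (F z + t) - G ζ)
  rw [sub_add_sub_cancel] at h4
  linarith

/-- If `F z` were in the open half plane, the contraction estimate with `ζ = F z` would give `z = G
(F z) ∈ T`. -/
theorem re_eq_zero (h : IsTractInverse F G T C) {z : ℂ} (hz : z ∈ closure T) (hzT : z ∉ T) :
    (F z).re = 0 := by
  by_contra hne
  have hpos : F z ∈ rightHalfPlane := lt_of_le_of_ne (h.re_nonneg hz) (Ne.symm hne)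
  have := h.norm_sub_inv_le hz hpos
  rw [sub_self, norm_zero, zero_div, norm_le_zero_iff, sub_eq_zero] at this
  exact hzT (this ▸ h.mapsTo_inv hpos)

theorem tendsto_norm_map (h : IsTractInverse F G T C) {ι : Type*} {l : Filter ι} {x : ι → ℂ}
    (hx : ∀ i, x i ∈ T) (hl : Tendsto (fun i => ‖x i‖) l atTop) :
    Tendsto (fun i => ‖F (x i)‖) l atTop := by
  have hH : (1 : ℂ) ∈ rightHalfPlane := by simp [rightHalfPlane]
  refine tendsto_atTop_mono (f := fun i => ‖x i‖ + (-‖G 1‖ - 1)) (fun i => ?_)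
    (tendsto_atTop_add_const_right _ _ hl)
  have h1 := h.norm_sub_inv_le (subset_closure (hx i)) hH
  have h2 := norm_sub_norm_le (x i) (G 1)
  have h3 := _root_.norm_sub_le (F (x i)) 1
  rw [norm_one] at h3
  linarith [norm_nonneg (F (x i))]

/-- `F` is bounded on bounded parts of the closure of `T`, by compactness. -/
theorem tendsto_norm_inv (h : IsTractInverse F G T C) {ι : Type*} {l : Filter ι} {x : ι → ℂ}
    (hx : ∀ i, x i ∈ rightHalfPlane) (hl : Tendsto (fun i => ‖x i‖) l atTop) :
    Tendsto (fun i => ‖G (x i)‖) l atTop := by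
  rw [tendsto_atTop]
  intro R
  obtain ⟨B, hB⟩ := ((isCompact_closedBall (0 : ℂ) R).inter_right
    isClosed_closure).exists_bound_of_continuousOn (h.continuousOn.mono inter_subset_right)
  filter_upwards [hl.eventually_gt_atTop B] with i hi
  by_contra! hlt
  have := hB (G (x i)) ⟨mem_closedBall_zero_iff.2 hlt.le, subset_closure (h.mapsTo_inv (hx i))⟩
  rw [h.right_inv _ (hx i)] at this
  linarith

/-- The preimages of horizontal rays are geodesics. -/
theorem exists_geodesic (h : IsTractInverse F G T C) {z₀ : ℂ} (hz₀ : z₀ ∈ closure T) :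
    ∃ S, IsGeodesicToInfinity T z₀ S ∧ ∀ t : ℝ, 0 < t → G (F z₀ + t) ∈ S := by
  have hmaps : MapsTo (fun u : ℂ => -Complex.I * u) UpperHalfPlane.upperHalfPlaneSet
      rightHalfPlane := by
    intro u hu
    change 0 < (-Complex.I * u).re
    simpa using hu
  have hconf : IsConformalIso (fun u => G (-Complex.I * u)) UpperHalfPlane.upperHalfPlaneSet T := by
    refine ⟨h.differentiableOn_inv.comp (by fun_prop) hmaps, h.mapsTo_inv.comp hmaps, ?_, ?_⟩
    · intro u hu v hv huv
      have := congrArg F huv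
      simp only [h.right_inv _ (hmaps hu), h.right_inv _ (hmaps hv)] at this
      exact mul_left_cancel₀ (neg_ne_zero.2 Complex.I_ne_zero) this
    · intro z hz
      refine ⟨Complex.I * F z, ?_, ?_⟩
      · change 0 < (Complex.I * F z).im
        have h1 : 0 < (F z).re := h.mapsTo hz
        simpa using h1
      · have : -Complex.I * (Complex.I * F z) = F z := by
          rw [← mul_assoc, neg_mul, Complex.I_mul_I, neg_neg, one_mul]
        simp only [this]
        exact h.left_inv z hz
  -- Unit-speed vertical lines, rotated to horizontal ones by `-I`. The height at time `0` is `A =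
  -- Re F z₀` for an interior point; for a boundary point the whole line with `A = 1` is used.
  obtain ⟨σ, hσ⟩ : ∃ σ : ℝ → ℝ → UpperHalfPlane, ∀ A, 0 < A → ∀ t,
      (σ A t : ℂ) = ⟨-(F z₀).im, A * Real.exp t⟩ := by
    refine ⟨fun A t => if hA : 0 < A then ⟨⟨-(F z₀).im, A * Real.exp t⟩, by positivity⟩ else
      UpperHalfPlane.I, fun A hA t => ?_⟩
    simp [hA]
  have hcurve : ∀ A, 0 < A → ∀ t, -Complex.I * (σ A t : ℂ) = ⟨A * Real.exp t, (F z₀).im⟩ := by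
    intro A hA t
    rw [hσ A hA]
    apply Complex.ext <;> simp
  have hdist : ∀ A, 0 < A → ∀ s t, dist (σ A s) (σ A t) = |s - t| := by
    intro A hA s t
    have him : ∀ t, (σ A t).im = A * Real.exp t := fun t => by
      rw [← UpperHalfPlane.coe_im, hσ A hA]
    rw [UpperHalfPlane.dist_of_re_eq, him, him, Real.log_mul hA.ne' (Real.exp_pos _).ne',
      Real.log_mul hA.ne' (Real.exp_pos _).ne', Real.log_exp, Real.log_exp, Real.dist_eq,
      add_sub_add_left_eq_sub]
    rw [← UpperHalfPlane.coe_re, ← UpperHalfPlane.coe_re, hσ A hA, hσ A hA]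
  have htop : ∀ A, 0 < A →
      Tendsto (fun t => G (-Complex.I * (σ A t : ℂ))) atTop (cocompact ℂ) := by
    intro A hA
    rw [← Metric.cobounded_eq_cocompact, ← tendsto_norm_atTop_iff_cobounded]
    refine h.tendsto_norm_inv (fun t => hmaps (σ A t).im_pos) ?_
    refine tendsto_atTop_mono (f := fun t => A * Real.exp t) (fun t => ?_)
      (Real.tendsto_exp_atTop.const_mul_atTop hA)
    rw [hcurve A hA]
    exact (le_abs_self _).trans (Complex.abs_re_le_norm ⟨A * Real.exp t, (F z₀).im⟩)
  by_cases hT : z₀ ∈ T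
  · have hA : 0 < (F z₀).re := h.mapsTo hT
    refine ⟨_, ⟨_, hconf, Or.inl ⟨hT, σ (F z₀).re, fun s _ t _ => hdist _ hA s t, ?_, htop _ hA,
      rfl⟩⟩, fun t ht => ?_⟩
    · rw [hcurve _ hA, Real.exp_zero, mul_one]
      exact h.left_inv z₀ hT
    · have hq : 1 ≤ ((F z₀).re + t) / (F z₀).re := by rw [one_le_div hA]; linarith
      refine ⟨Real.log (((F z₀).re + t) / (F z₀).re), Real.log_nonneg hq, ?_⟩
      simp only
      rw [hcurve _ hA, Real.exp_log (by linarith), mul_div_cancel₀ _ hA.ne']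
      congr 1
      apply Complex.ext <;> simp
  · have hre := h.re_eq_zero hz₀ hT
    refine ⟨_, ⟨_, hconf, Or.inr ⟨?_, σ 1, hdist _ one_pos, ?_, htop _ one_pos, rfl⟩⟩,
      fun t ht => ⟨Real.log t, ?_⟩⟩
    · rw [frontier, h.isOpen.interior_eq]
      exact ⟨hz₀, hT⟩
    · rw [tendsto_iff_norm_sub_tendsto_zero]
      refine squeeze_zero (fun _ => norm_nonneg _) (fun t => ?_) Real.tendsto_exp_atBot
      have hF : F z₀ - ⟨1 * Real.exp t, (F z₀).im⟩ = ((-Real.exp t : ℝ) : ℂ) := by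
        apply Complex.ext <;> simp [hre, -Complex.ofReal_exp]
      have h1 := h.norm_sub_inv_le hz₀ (ζ := -Complex.I * (σ 1 t : ℂ)) (hmaps (σ 1 t).im_pos)
      rw [norm_sub_rev]
      rw [hcurve _ one_pos] at h1 ⊢
      rw [hF, Complex.norm_real, norm_neg, Real.norm_of_nonneg (Real.exp_pos t).le] at h1
      linarith [Real.exp_pos t]
    · simp only
      rw [hcurve _ one_pos, Real.exp_log ht, one_mul]
      congr 1
      apply Complex.ext <;> simp [hre]

/-- Geodesics to infinity are preimages of horizontal rays. -/
theorem mem_geodesic (h : IsTractInverse F G T C) {z₀ : ℂ} (hz₀ : z₀ ∈ closure T) {S : Set ℂ}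
    (hS : IsGeodesicToInfinity T z₀ S) {z : ℂ} (hz : z ∈ S) :
    z ∈ T ∧ (F z).im = (F z₀).im ∧ (F z₀).re ≤ (F z).re := by
  obtain ⟨f, hf, hS⟩ := hS
  obtain ⟨k, ⟨hkd, hkb⟩, hkl, -⟩ := hf.exists_inverse UpperHalfPlane.isOpen_upperHalfPlaneSet
  have hfT : ∀ u : UpperHalfPlane, f u ∈ T := fun u => hf.2.mapsTo u.im_pos
  have hmaps : MapsTo (fun u : ℂ => -Complex.I * u) UpperHalfPlane.upperHalfPlaneSet
      rightHalfPlane := by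
    intro u hu
    change 0 < (-Complex.I * u).re
    simpa using hu
  have hmaps' : MapsTo (fun u : ℂ => Complex.I * F (f u)) UpperHalfPlane.upperHalfPlaneSet
      UpperHalfPlane.upperHalfPlaneSet := by
    intro u hu
    change 0 < (Complex.I * F (f u)).im
    have h1 : 0 < (F (f u)).re := h.mapsTo (hf.2.mapsTo hu)
    simpa using h1
  obtain ⟨τ, hτ⟩ : ∃ τ : UpperHalfPlane → UpperHalfPlane, ∀ u, (τ u : ℂ) = Complex.I * F (f u) :=
    ⟨fun u => ⟨_, hmaps' u.im_pos⟩, fun u => rfl⟩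
  -- Schwarz–Pick for the map and for its inverse makes `τ` an isometry.
  have hdist : ∀ u v, dist (τ u) (τ v) = dist u v := by
    intro u v
    refine le_antisymm (UpperHalfPlane.dist_le_dist_of_mapsTo
      ((h.differentiableOn.comp hf.1 hf.2.mapsTo).const_mul Complex.I) hmaps' (hτ u).symm
      (hτ v).symm) ?_
    have hinv : ∀ u, k (G (-Complex.I * (τ u : ℂ))) = u := fun u => by
      rw [hτ, ← mul_assoc, neg_mul, Complex.I_mul_I, neg_neg, one_mul, h.left_inv _ (hfT u)]
      exact hkl _ u.im_pos
    exact UpperHalfPlane.dist_le_dist_of_mapsTo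
      (hkd.comp (h.differentiableOn_inv.comp (by fun_prop) hmaps) (h.mapsTo_inv.comp hmaps))
      (hkb.mapsTo.comp (h.mapsTo_inv.comp hmaps)) (hinv u) (hinv v)
  have hre : ∀ u, (τ u).re = -(F (f u)).im := fun u => by
    rw [← UpperHalfPlane.coe_re, hτ]; simp
  have him : ∀ u, (τ u).im = (F (f u)).re := fun u => by
    rw [← UpperHalfPlane.coe_im, hτ]; simp
  have hnorm : ∀ σ : ℝ → UpperHalfPlane, Tendsto (fun t => f (σ t)) atTop (cocompact ℂ) →
      Tendsto (fun t => ‖(τ (σ t) : ℂ)‖) atTop atTop := by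
    intro σ hσ
    rw [← Metric.cobounded_eq_cocompact, ← tendsto_norm_atTop_iff_cobounded] at hσ
    refine (h.tendsto_norm_map (fun t => hfT (σ t)) hσ).congr fun t => ?_
    rw [hτ, norm_mul, Complex.norm_I, one_mul]
  rcases hS with ⟨-, σ, hσ, h0, htop, rfl⟩ | ⟨-, σ, hσ, hbot, htop, rfl⟩
  · obtain ⟨t, ht, rfl⟩ := hz
    have hv := UpperHalfPlane.vertical_of_isometric_ray (τ := fun t => τ (σ t))
      (fun s hs t ht => by rw [hdist, hσ s hs t ht]) (hnorm σ htop) le_rfl ht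
    rw [hre, hre, him, him, h0] at hv
    exact ⟨hfT _, neg_injective hv.1, hv.2⟩
  · obtain ⟨t, rfl⟩ := hz
    -- The line is cut at time `s` into a ray; `s → -∞` then recovers the endpoint through
    -- continuity of `F` at `z₀`.
    have hv : ∀ s ≤ t, (F (f (σ t))).im = (F (f (σ s))).im ∧
        (F (f (σ s))).re ≤ (F (f (σ t))).re := by
      intro s hs
      have hv := UpperHalfPlane.vertical_of_isometric_ray (τ := fun r => τ (σ (r + s)))
        (fun a _ b _ => by rw [hdist, hσ, add_sub_add_right_eq_sub])
        ((hnorm σ htop).comp (tendsto_atTop_add_const_right _ s tendsto_id)) le_rfl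
        (sub_nonneg.2 hs)
      simp only [zero_add, sub_add_cancel] at hv
      rw [hre, hre, him, him] at hv
      exact ⟨neg_injective hv.1, hv.2⟩
    have hlim : Tendsto (fun s => F (f (σ s))) atBot (𝓝 (F z₀)) :=
      (h.continuousOn z₀ hz₀).tendsto.comp (tendsto_nhdsWithin_iff.2
        ⟨hbot, Eventually.of_forall fun s => subset_closure (hfT _)⟩)
    refine ⟨hfT _, ?_, ?_⟩
    · refine tendsto_nhds_unique ?_ ((Complex.continuous_im.tendsto _).comp hlim)
      refine tendsto_const_nhds.congr' ?_
      filter_upwards [eventually_le_atBot t] with s hs using (hv s hs).1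
    · refine le_of_tendsto ((Complex.continuous_re.tendsto _).comp hlim) ?_
      filter_upwards [eventually_le_atBot t] with s hs using (hv s hs).2

end IsTractInverse

/-! ### Slope, periodicity and elementary estimates. -/

theorem HasBoundedSlope.closure {D : Set ℂ} {α β : ℝ} (h : HasBoundedSlope D α β) {T : Set ℂ}
    (hT : T ∈ tracts D) {z w : ℂ} (hz : z ∈ closure T) (hw : w ∈ closure T) :
    |z.im - w.im| ≤ α * max (max z.re w.re) 0 + β := by
  have hcl : IsClosed {p : ℂ × ℂ | |p.1.im - p.2.im| ≤ α * max (max p.1.re p.2.re) 0 + β} := by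
    refine isClosed_le ?_ ?_ <;> fun_prop
  have hsub := closure_minimal (s := T ×ˢ T) (fun p hp => h T hT p.1 hp.1 p.2 hp.2) hcl
  rw [closure_prod_eq] at hsub
  exact hsub (mk_mem_prod hz hw)

/-- Translates of tracts by multiples of `2πi` are tracts. -/
theorem IsBlog.translate_mem_tracts {D H : Set ℂ} {F : ℂ → ℂ} (hF : IsBlog D H F) {T : Set ℂ}
    (hT : T ∈ tracts D) (k : ℤ) :
    (fun z => z + k * (2 * Real.pi * Complex.I)) '' T ∈ tracts D := by
  have hper : ∀ (k : ℤ) (z : ℂ), z + k * (2 * Real.pi * Complex.I) ∈ D ↔ z ∈ D := by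
    intro k
    induction k with
    | zero => simp
    | succ n ih =>
      intro z
      rw [← ih z, ← hF.periodic_domain (z + (n : ℤ) * (2 * Real.pi * Complex.I))]
      push_cast
      ring_nf
    | pred n ih =>
      intro z
      rw [← ih z, ← hF.periodic_domain]
      push_cast
      ring_nf
  obtain ⟨z, hz, rfl⟩ := hT
  refine ⟨z + k * (2 * Real.pi * Complex.I), (hper k z).2 hz, ?_⟩
  have himage : (Homeomorph.addRight ((k : ℂ) * (2 * Real.pi * Complex.I))) '' D = D := by
    ext w
    constructor
    · rintro ⟨x, hx, rfl⟩
      exact (hper k x).2 hx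
    · intro hw
      refine ⟨w - k * (2 * Real.pi * Complex.I), (hper k _).1 (by rwa [sub_add_cancel]), ?_⟩
      simp
  have := (Homeomorph.addRight ((k : ℂ) * (2 * Real.pi * Complex.I))).image_connectedComponentIn hz
  rw [himage] at this
  exact this

/-- A tract contains points of all sufficiently large real parts. -/
theorem IsBlog.exists_re_eq {D H : Set ℂ} {F : ℂ → ℂ} (hF : IsBlog D H F) {T : Set ℂ}
    (hT : T ∈ tracts D) : ∃ R : ℝ, 1 ≤ R ∧ ∀ x, R ≤ x → ∃ p ∈ T, p.re = x := by
  obtain ⟨p, hp⟩ := (hF.jordan_tract T hT).2.1.nonempty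
  refine ⟨max 1 p.re, le_max_left _ _, fun x hx => ?_⟩
  obtain ⟨-, ⟨q, hq, rfl⟩, hxq⟩ := not_bddAbove_iff.1 (hF.re_not_bddAbove T hT) x
  obtain ⟨r, hr, hrx⟩ := (hF.jordan_tract T hT).2.1.isPreconnected.intermediate_value hp hq
    Complex.continuous_re.continuousOn ⟨(le_max_right _ _).trans hx, hxq.le⟩
  exact ⟨r, hr, hrx⟩

theorem exists_int_abs_add_le_pi (x y : ℝ) : ∃ k : ℤ, |x + k * (2 * Real.pi) - y| ≤ Real.pi := by
  have hpi := Real.pi_pos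
  refine ⟨round ((y - x) / (2 * Real.pi)), ?_⟩
  have h1 := abs_sub_round ((y - x) / (2 * Real.pi))
  have h2 : x + round ((y - x) / (2 * Real.pi)) * (2 * Real.pi) - y =
      -((y - x) / (2 * Real.pi) - round ((y - x) / (2 * Real.pi))) * (2 * Real.pi) := by
    field_simp
    ring
  rw [h2, abs_mul, abs_neg, abs_of_pos (show 0 < 2 * Real.pi by positivity)]
  nlinarith

theorem norm_le_of_re_eq_zero {z : ℂ} {B : ℝ} (h : z.re = 0) (hB : |z.im| ≤ B) : ‖z‖ ≤ B := by
  have := Complex.norm_le_abs_re_add_abs_im z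
  rw [h, abs_zero, zero_add] at this
  exact this.trans hB

theorem re_le_re_add_of_norm_sub_le {z w : ℂ} {B : ℝ} (h : ‖z - w‖ ≤ B) : z.re ≤ w.re + B := by
  have h1 := (abs_le.1 ((Complex.abs_re_le_norm (z - w)).trans h)).2
  rw [Complex.sub_re] at h1
  linarith

theorem max_re_le_add_of_norm_sub_le {z w : ℂ} {B : ℝ} (h : ‖z - w‖ ≤ B) :
    max z.re 0 ≤ max w.re 0 + B := by
  have hB := (norm_nonneg _).trans h
  refine max_le ?_ ?_
  · have := re_le_re_add_of_norm_sub_le h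
    have := le_max_left w.re 0
    linarith
  · have := le_max_right w.re 0
    linarith

/-! ### The implications between the three conditions. -/

section

variable {D : Set ℂ} {F : ℂ → ℂ} {α β K : ℝ}

theorem UniformLinearHeadStart.exists_boundedWiggling (hα : 0 < α) (hβ : 0 < β)
    (hF : IsNormalizedBlog D F) (hslope : HasBoundedSlope D α β) (hK : 1 < K) {M : ℝ} (hM : 0 < M)
    (h : UniformLinearHeadStart D F K M) : ∃ μ : ℝ, 0 < μ ∧ UniformlyBoundedWiggling D K μ := by
  rcases (tracts D).eq_empty_or_nonempty with hD | ⟨T₀, hT₀⟩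
  · exact ⟨1, one_pos, fun T hT => by simp [hD] at hT⟩
  obtain ⟨R, hR, hR'⟩ := hF.isBlog.exists_re_eq hT₀
  have hpi := Real.pi_pos
  -- `R / 2` pays for the shift right by `R`, the rest for the vertical displacement, which is at
  -- most `α + β + π` times the height because that height is at least `1`.
  obtain ⟨B, hB⟩ : ∃ B, B = R / 2 + 96 * Real.pi * (α + β + Real.pi) := ⟨_, rfl⟩
  have hB0 : 0 < B := by rw [hB]; positivity
  have hK0 : 0 < K := by linarith
  refine ⟨B + (M + B) / K + 1, by positivity, fun T hT z₀ hz₀ S hS z hz => ?_⟩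
  obtain ⟨G, hG⟩ := hF.exists_inverse hT
  obtain ⟨hzT, him, hre⟩ := hG.mem_geodesic hz₀ hS hz
  have hc := hG.re_nonneg hz₀
  obtain ⟨p, hp, hpre⟩ := hR' ((F z₀).re + R) (by linarith)
  obtain ⟨q, hq, hqre⟩ := hR' ((F z).re + R) (by linarith)
  obtain ⟨k, hk⟩ := exists_int_abs_add_le_pi p.im (F z₀).im
  have hT' := hF.isBlog.translate_mem_tracts hT₀ k
  set T' := (fun z => z + (k : ℂ) * (2 * Real.pi * Complex.I)) '' T₀
  have hshift : ((k : ℂ) * (2 * Real.pi * Complex.I)).re = 0 ∧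
      ((k : ℂ) * (2 * Real.pi * Complex.I)).im = k * (2 * Real.pi) := by
    constructor <;> simp
  obtain ⟨p', hp', hp're, hp'im⟩ : ∃ p' ∈ T', p'.re = (F z₀).re + R ∧
      |p'.im - (F z₀).im| ≤ Real.pi := by
    refine ⟨_, mem_image_of_mem _ hp, ?_, ?_⟩
    · rw [Complex.add_re, hshift.1, add_zero, hpre]
    · rwa [Complex.add_im, hshift.2]
  obtain ⟨q', hq', hq're⟩ : ∃ q' ∈ T', q'.re = (F z).re + R := by
    refine ⟨_, mem_image_of_mem _ hq, ?_⟩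
    rw [Complex.add_re, hshift.1, add_zero, hqre]
  have hq'im : |q'.im - (F z).im| ≤ α * ((F z).re + R) + β + Real.pi := by
    have h1 := hslope T' hT' q' hq' p' hp'
    rw [hp're, hq're, max_eq_left (show (F z₀).re + R ≤ (F z).re + R by linarith),
      max_eq_left (by linarith)] at h1
    have h2 := abs_sub_le q'.im p'.im (F z).im
    rw [him] at h2 ⊢
    linarith
  have hnear : ∀ x ∈ closure T, ∀ y : ℂ, y.re = (F x).re + R →
      |y.im - (F x).im| ≤ α * ((F x).re + R) + β + Real.pi → ‖x - G y‖ ≤ B := by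
    intro x hx y hyre hyim
    have hx0 := hG.re_nonneg hx
    have hL : 1 ≤ (F x).re + R := by linarith
    have h1 := hG.norm_sub_inv_le_add hx (t := R) (L := (F x).re + R) (ζ := y) (by linarith)
      (by linarith) le_rfl hyre.ge
    have h2 : ‖F x + R - y‖ ≤ α * ((F x).re + R) + β + Real.pi := by
      refine norm_le_of_re_eq_zero (by simp [hyre]) ?_
      rw [abs_sub_comm] at hyim
      simpa using hyim
    have h3 : ‖F x + R - y‖ / ((F x).re + R) ≤ α + β + Real.pi := by
      rw [div_le_iff₀ (by linarith)]
      nlinarith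
    have h4 := mul_le_mul_of_nonneg_left h3 (show 0 ≤ 96 * Real.pi by positivity)
    linarith
  have hz₀p := hnear z₀ hz₀ p' hp're (by nlinarith)
  have hzq := hnear z (subset_closure hzT) q' hq're hq'im
  have hp'H : p' ∈ rightHalfPlane := by change 0 < p'.re; linarith
  have hq'H : q' ∈ rightHalfPlane := by change 0 < q'.re; linarith
  -- Only the first step of the address `T, T', T', …` matters.
  have hpair : PairHeadStart F (fun t => K * max t 0 + M) T T' := by
    have := (h.2 (fun n => if n = 0 then T else T') fun n => by
      dsimp only
      split_ifs
      exacts [hT, hT']).1 0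
    simpa using this
  have hnot := hpair (G q') (subset_closure (hG.mapsTo_inv hq'H)) (G p')
    (subset_closure (hG.mapsTo_inv hp'H)) (by rw [hG.right_inv _ hq'H]; exact subset_closure hq')
    (by rw [hG.right_inv _ hp'H]; exact subset_closure hp')
  rw [hG.right_inv _ hq'H, hG.right_inv _ hp'H] at hnot
  -- Otherwise the head start would give `Re p' > K Re q' + M`, although `Re p' ≤ Re q'`.
  have hle : (G p').re ≤ K * max (G q').re 0 + M := by
    by_contra! hlt
    have h1 := hnot hlt
    simp only at h1
    have h2 := le_max_left q'.re 0
    nlinarith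
  have h1 := re_le_re_add_of_norm_sub_le hz₀p
  rw [norm_sub_rev] at hzq
  have h2 := max_re_le_add_of_norm_sub_le hzq
  have h3 : z₀.re ≤ K * (max z.re 0 + B) + M + B := by nlinarith
  have h4 : 1 / K * z₀.re ≤ 1 / K * (K * (max z.re 0 + B) + M + B) :=
    mul_le_mul_of_nonneg_left h3 (by positivity)
  have h5 : 1 / K * (K * (max z.re 0 + B) + M + B) = max z.re 0 + B + (M + B) / K := by
    field_simp
    ring
  linarith

/-- On a geodesic the imaginary part of `F` is constant, so the hypothesis on imaginary parts is
automatic; its real part is at least that of `F z₀`, so the conclusion must fail. -/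
theorem StrongLinearHeadStart.exists_boundedWiggling (hα : 0 < α) (hβ : 0 < β)
    (hF : IsNormalizedBlog D F) (hK : 1 < K) {M : ℝ} (hM : 0 < M)
    (h : StrongLinearHeadStart D F α β K M) : ∃ μ : ℝ, 0 < μ ∧ UniformlyBoundedWiggling D K μ := by
  have hK0 : 0 < K := by linarith
  refine ⟨M / K + 1, by positivity, fun T hT z₀ hz₀ S hS z hz => ?_⟩
  obtain ⟨G, hG⟩ := hF.exists_inverse hT
  obtain ⟨hzT, him, hre⟩ := hG.mem_geodesic hz₀ hS hz
  have hc := hG.re_nonneg hz₀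
  have hle : z₀.re ≤ K * max z.re 0 + M := by
    by_contra! hlt
    have h1 := h T hT z (subset_closure hzT) z₀ hz₀ hlt (by
      rw [him, sub_self, abs_zero]
      have := le_max_right (F z).re (F z₀).re
      nlinarith)
    nlinarith
  have h4 : 1 / K * z₀.re ≤ 1 / K * (K * max z.re 0 + M) :=
    mul_le_mul_of_nonneg_left hle (by positivity)
  have h5 : 1 / K * (K * max z.re 0 + M) = max z.re 0 + M / K := by
    field_simp
  linarith

theorem UniformlyBoundedWiggling.exists_strongLinearHeadStart (hα : 0 < α) (hβ : 0 < β)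
    (hF : IsNormalizedBlog D F) (hK : 1 < K) {μ : ℝ} (hμ : 0 < μ)
    (h : UniformlyBoundedWiggling D K μ) : ∃ M : ℝ, 0 < M ∧ StrongLinearHeadStart D F α β K M := by
  have hK0 : 0 < K := by linarith
  obtain ⟨C, hC⟩ : ∃ C, C = 96 * Real.pi := ⟨_, rfl⟩
  have hC0 : 0 < C := by rw [hC]; have := Real.pi_pos; positivity
  -- The estimate for `‖z - G ζ‖` contains `M` with factor `C (1 + α) / L`. This `L` makes it `1 /
  -- (2K)`, half of the gain `M / K` from dividing the hypothesis by `K`; the other half, `B`,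
  -- absorbs all constants, whence `M = 2KB`.
  obtain ⟨L, hL⟩ : ∃ L, L = 2 * C * K * (1 + α) := ⟨_, rfl⟩
  have hL0 : 0 < L := by rw [hL]; positivity
  obtain ⟨B, hB⟩ : ∃ B, B = μ + L / 2 + C * (K - 1 + α * K) + C * β / L := ⟨_, rfl⟩
  have hB0 : 0 < B := by
    have : 0 < K - 1 := by linarith
    rw [hB]; positivity
  refine ⟨2 * K * B, by positivity, fun T hT z hz w hw hzw him => ?_⟩
  obtain ⟨M, hM⟩ : ∃ M, M = 2 * K * B := ⟨_, rfl⟩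
  rw [← hM] at hzw ⊢
  have hM0 : 0 < M := by rw [hM]; positivity
  obtain ⟨G, hG⟩ := hF.exists_inverse hT
  rw [← hC] at hG
  have ha := hG.re_nonneg hz
  have hc := hG.re_nonneg hw
  by_contra! hle
  obtain ⟨m, hm⟩ : ∃ m, m = max (F z).re (F w).re := ⟨_, rfl⟩
  rw [← hm] at him
  have hma : (F z).re ≤ m := by rw [hm]; exact le_max_left _ _
  have hmc : (F w).re ≤ m := by rw [hm]; exact le_max_right _ _
  have hmK : m ≤ K * (F z).re + M := by
    rw [hm]
    exact max_le (by nlinarith) hle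
  obtain ⟨S, hS, hS'⟩ := hG.exists_geodesic hw
  -- The geodesic point lies over height `m + L`, to the right of both `F z` and `F w`.
  have hwig := h T hT w hw S hS _ (hS' (m - (F w).re + L) (by linarith))
  set ζ : ℂ := F w + ((m - (F w).re + L : ℝ) : ℂ)
  have hζre : ζ.re = m + L := by
    simp only [ζ, Complex.add_re, Complex.ofReal_re]
    ring
  have hζim : ζ.im = (F w).im := by simp [ζ]
  have hdist := hG.norm_sub_inv_le_add hz (ζ := ζ) hL0 (show 0 < (F z).re + L by linarith) le_rfl
    (by rw [hζre]; linarith)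
  have hnorm : ‖F z + L - ζ‖ ≤ (m - (F z).re) + (α * m + β) := by
    refine (Complex.norm_le_abs_re_add_abs_im _).trans (add_le_add ?_ ?_)
    · rw [Complex.sub_re, hζre, Complex.add_re, Complex.ofReal_re, abs_sub_comm]
      rw [abs_of_nonneg (by linarith)]
      linarith
    · rw [Complex.sub_im, hζim, Complex.add_im, Complex.ofReal_im, add_zero]
      exact him
  have hquot : ‖F z + L - ζ‖ / ((F z).re + L) ≤ (K - 1 + α * K) + ((1 + α) * M + β) / L := by
    rw [div_le_iff₀ (by linarith)]
    have h1 : ((1 + α) * M + β) / L * L = (1 + α) * M + β := div_mul_cancel₀ _ hL0.ne'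
    have h2 : 0 ≤ ((1 + α) * M + β) / L := by positivity
    have h3 : 0 ≤ K - 1 + α * K := by nlinarith
    have h4 := mul_nonneg h2 ha
    have h5 := mul_nonneg h3 hL0.le
    have h6 := mul_le_mul_of_nonneg_left hmK hα.le
    linarith
  have hCq := mul_le_mul_of_nonneg_left hquot hC0.le
  have hterm : C * (((1 + α) * M + β) / L) = M / (2 * K) + C * β / L := by
    rw [hL]
    field_simp
  rw [mul_add, hterm] at hCq
  have hfin : ‖G ζ - z‖ ≤ L / 2 + (C * (K - 1 + α * K) + (M / (2 * K) + C * β / L)) := by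
    rw [norm_sub_rev]
    linarith
  have h1 := max_re_le_add_of_norm_sub_le hfin
  have h2 : M / (2 * K) = B := by rw [hM]; field_simp
  have h3 : 1 / K * (K * max z.re 0 + M) < 1 / K * w.re :=
    mul_lt_mul_of_pos_left hzw (by positivity)
  have h4 : 1 / K * (K * max z.re 0 + M) = max z.re 0 + 2 * B := by
    rw [hM]; field_simp
  rw [h2] at h1
  linarith

/-- Points of the closure of a tract whose images are at comparable height have bounded
distance. -/
theorem IsTractInverse.norm_sub_le_of_comparable {G : ℂ → ℂ} {T : Set ℂ} {C M : ℝ}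
    (hG : IsTractInverse F G T C) (hC : 0 ≤ C) (hα : 0 < α) (hβ : 0 < β) (hK : 1 < K) (hM : 0 < M)
    {z w : ℂ} (hz : z ∈ closure T) (hw : w ∈ closure T) (hzw : (F z).re ≤ (F w).re)
    (hle : (F w).re ≤ K * (F z).re + M) (him : |(F z).im - (F w).im| ≤ α * (F w).re + β) :
    ‖z - w‖ ≤ 1 + C * ((K - 1 + α * K) + ((1 + α) * M + β)) := by
  have ha := hG.re_nonneg hz
  have hc := hG.re_nonneg hw
  have hre : (F w + ((1 : ℝ) : ℂ)).re = (F w).re + 1 := by simp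
  -- Shifting both images right by `1` avoids the blow-up of the bound `C / Re ζ` at the imaginary
  -- axis; each shift costs `1 / 2`.
  have h1 := hG.norm_sub_inv_le_add hz (ζ := F w + ((1 : ℝ) : ℂ)) one_pos
    (show 0 < (F z).re + 1 by linarith) le_rfl (by rw [hre]; linarith)
  have h2 := hG.norm_sub_inv_le hw (ζ := F w + ((1 : ℝ) : ℂ)) (by
    change 0 < (F w + ((1 : ℝ) : ℂ)).re
    rw [hre]
    linarith)
  rw [sub_add_cancel_left, norm_neg, Complex.norm_real, norm_one] at h2
  rw [add_sub_add_right_eq_sub] at h1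
  have hnorm : ‖F z - F w‖ ≤ ((F w).re - (F z).re) + (α * (F w).re + β) := by
    refine (Complex.norm_le_abs_re_add_abs_im _).trans (add_le_add ?_ ?_)
    · rw [Complex.sub_re, abs_sub_comm, abs_of_nonneg (by linarith)]
    · exact him
  have hquot : ‖F z - F w‖ / ((F z).re + 1) ≤ (K - 1 + α * K) + ((1 + α) * M + β) := by
    rw [div_le_iff₀ (by linarith)]
    have h3 : 0 ≤ K - 1 + α * K := by nlinarith
    have h4 : 0 ≤ ((1 + α) * M + β) * (F z).re := by positivity
    have h6 := mul_le_mul_of_nonneg_left hle hα.le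
    linarith
  have h3 := mul_le_mul_of_nonneg_left hquot hC
  have h4 := norm_sub_le_norm_sub_add_norm_sub z (G (F w + ((1 : ℝ) : ℂ))) w
  rw [norm_sub_rev (G _) w] at h4
  linarith

theorem StrongLinearHeadStart.uniformLinearHeadStart (hα : 0 < α) (hβ : 0 < β)
    (hF : IsNormalizedBlog D F) (hslope : HasBoundedSlope D α β) (hK : 1 < K) {M : ℝ} (hM : 0 < M)
    (h : StrongLinearHeadStart D F α β K M) : UniformLinearHeadStart D F K M := by
  have hK0 : 0 < K := by linarith
  have hpi := Real.pi_pos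
  refine ⟨⟨fun x y hxy => ?_, by fun_prop, fun x => ?_⟩, fun s hs => ⟨fun k => ?_, ?_⟩⟩
  · dsimp only
    gcongr
  · have h1 := le_max_left x 0
    have h2 := le_max_right x 0
    nlinarith
  · intro z hz w hw hFz hFw hzw
    obtain ⟨G, hG⟩ := hF.exists_inverse (hs k)
    have ha := hG.re_nonneg hz
    have hc := hG.re_nonneg hw
    have hsl := hslope.closure (hs (k + 1)) hFz hFw
    rw [max_eq_left (ha.trans (le_max_left _ _))] at hsl
    have := h _ (hs k) z hz w hw hzw hsl
    simp only
    rwa [max_eq_left ha]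
  · rintro z ⟨-, hz⟩ w ⟨-, hw⟩ hne
    by_contra! hcon
    obtain ⟨B, hB⟩ : ∃ B, B = 1 + 96 * Real.pi * ((K - 1 + α * K) + ((1 + α) * M + β)) := ⟨_, rfl⟩
    -- Failure of the head start at time `n + 1` makes the heights there comparable, which bounds
    -- the distance at time `n`.
    have hbound : ∀ n, ‖F^[n] z - F^[n] w‖ ≤ B := by
      intro n
      obtain ⟨G, hG⟩ := hF.exists_inverse (hs n)
      have ha := hG.re_nonneg (hz n)
      have hc := hG.re_nonneg (hw n)
      have hcn := hcon (n + 1)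
      have hzn := hz (n + 1)
      have hwn := hw (n + 1)
      simp only [Function.iterate_succ_apply'] at hcn hzn hwn
      have hsl := hslope.closure (hs (n + 1)) hzn hwn
      rw [max_eq_left (ha.trans (le_max_left _ _))] at hsl
      rw [max_eq_left ha, max_eq_left hc] at hcn
      rw [hB]
      rcases le_total (F (F^[n] z)).re (F (F^[n] w)).re with hle | hle
      · rw [max_eq_right hle] at hsl
        exact hG.norm_sub_le_of_comparable (by positivity) hα hβ hK hM (hz n) (hw n) hle hcn.2 hsl
      · rw [max_eq_left hle, abs_sub_comm] at hsl
        rw [norm_sub_rev]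
        exact hG.norm_sub_le_of_comparable (by positivity) hα hβ hK hM (hw n) (hz n) hle hcn.1 hsl
    have hexp : ∀ n : ℕ, 2 ^ n * ‖z - w‖ ≤ ‖F^[n] z - F^[n] w‖ := by
      intro n
      induction n with
      | zero => simp
      | succ n ih =>
        obtain ⟨G, hG⟩ := hF.exists_inverse (hs n)
        have h1 := hG.norm_sub_le (hz n) (hw n)
        simp only [Function.iterate_succ_apply']
        rw [pow_succ]
        linarith
    have hpos : 0 < ‖z - w‖ := norm_pos_iff.2 (sub_ne_zero.2 hne)
    obtain ⟨n, hn⟩ := pow_unbounded_of_one_lt (B / ‖z - w‖) (one_lt_two (α := ℝ))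
    rw [div_lt_iff₀ hpos] at hn
    linarith [hbound n, hexp n]

end

theorem proposition5p4 (D : Set ℂ) (F : ℂ → ℂ) (α β K : ℝ) (hα : 0 < α) (hβ : 0 < β)
    (hF : IsNormalizedBlog D F) (hslope : HasBoundedSlope D α β) (hK : 1 < K) :
    List.TFAE
      [∃ M : ℝ, 0 < M ∧ UniformLinearHeadStart D F K M,
       ∃ μ : ℝ, 0 < μ ∧ UniformlyBoundedWiggling D K μ,
       ∃ M : ℝ, 0 < M ∧ StrongLinearHeadStart D F α β K M] := by
  tfae_have 1 → 2 := fun ⟨_, hM, h⟩ => h.exists_boundedWiggling hα hβ hF hslope hK hM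
  tfae_have 2 → 3 := fun ⟨_, hμ, h⟩ => h.exists_strongLinearHeadStart hα hβ hF hK hμ
  tfae_have 3 → 1 := fun ⟨M, hM, h⟩ => ⟨M, hM, h.uniformLinearHeadStart hα hβ hF hslope hK hM⟩
  tfae_finish
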